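/- Let $a>1/2$ and $\alpha=1/a\in(0,2)$. Let $G_1<G_2<\dots$ be the arrival times of a Poisson process of intensity $1$ on $[0,\infty)$ (so that $G_1,G_2-G_1,G_3-G_2,\dots$ are i.i.d. exponential with mean $1$), and put $G_0=1$. Let $\varepsilon_1,\varepsilon_2,\dots$ be i.i.d. real random variables, independent of $(G_n)_{n\ge1}$, with a symmetric distribution ($\varepsilon_1$ and $-\varepsilon_1$ have the same law) and $\mathbb E|\varepsilon_1|^\alpha<\infty$. Define $$X_0=1,\qquad X_n=\Bigl(\frac{G_n}{G_{n-1}}\Bigr)^a X_{n-1}+\varepsilon_n,\quad n=1,2,\dots$$ Then $X_n/n^a$ converges in distribution as $n\to\infty$, and the limit law is the stable law with index of stability $\alpha$, location parameter $1$, skewness $\beta=0$ and scale parameter $$\sigma=\Bigl(\frac{\mathbb E|\varepsilon_1|^\alpha}{c_\alpha}\Bigr)^{a},\qquad c_\alpha=\frac{1-\alpha}{\Gamma(2-\alpha)\cos(\pi\alpha/2)}\ \text{ for }\alpha\neq1,\qquad c_1=\frac2\pi,$$ that is, the probability law on $\mathbb R$ with characteristic function $t\mapsto\exp\bigl(it-\sigma^\alpha|t|^\alpha\bigr)$.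 (If $\varepsilon_1=0$ almost surely, then $\sigma=0$ and the limit is the point mass at $1$.) -/

import Mathlib

open MeasureTheory ProbabilityTheory Filter

noncomputable section

/-- The gaps `G₁, G₂ - G₁, G₃ - G₂, …` of a sequence of times `G₁, G₂, …`; the entry `G 0`
is not used. -/
def interarrival {Ω : Type*} (G : ℕ → Ω → ℝ) : ℕ → Ω → ℝ
  | 0 => G 1
  | n + 1 => fun ω => G (n + 2) ω - G (n + 1) ω

/-- `G₁, G₂, …` are the arrival times of a Poisson process of intensity `r` on `[0, ∞)`: the
waiting times `G₁, G₂ - G₁, …` are independent and exponentially distributed with rate `r`. -/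
structure IsPoissonArrivalTimes {Ω : Type*} [MeasurableSpace Ω] (r : ℝ) (G : ℕ → Ω → ℝ)
    (P : Measure Ω) : Prop where
  indep : iIndepFun (interarrival G) P
  law : ∀ n, HasLaw (interarrival G n) (expMeasure r) P

/-- The logarithm of the characteristic function of the stable law `S_α(σ, β, m)`. -/
def stableExponent (α σ β m t : ℝ) : ℂ :=
  if α = 1 then
    -((σ * |t| : ℝ) : ℂ) * (1 + Complex.I * ((β * (2 / Real.pi) * t.sign * Real.log |t| : ℝ) : ℂ))
      + Complex.I * ((m * t : ℝ) : ℂ)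
  else
    -((σ ^ α * |t| ^ α : ℝ) : ℂ) *
        (1 - Complex.I * ((β * t.sign * Real.tan (Real.pi * α / 2) : ℝ) : ℂ))
      + Complex.I * ((m * t : ℝ) : ℂ)

/-- `ν` is the stable law `S_α(σ, β, m)` with index of stability `α`, scale `σ`, skewness `β`
and location `m`. -/
structure IsStableLaw (α σ β m : ℝ) (ν : Measure ℝ) : Prop where
  index_pos : 0 < α
  index_le : α ≤ 2
  scale_nonneg : 0 ≤ σ
  skewness : |β| ≤ 1
  isProb : IsProbabilityMeasure ν
  charFun_eq : ∀ t : ℝ, charFun ν t = Complex.exp (stableExponent α σ β m t)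

/-- The constant `c_α`. -/
def stableConst (α : ℝ) : ℝ :=
  if α = 1 then 2 / Real.pi
  else (1 - α) / (Real.Gamma (2 - α) * Real.cos (Real.pi * α / 2))

end

/-!
Multiplying out the recursion gives `X_n = G_n ^ a * (1 + ∑ k ∈ [1, n], G_k ^ (-a) * ε_k)`, and
`(G_n / n) ^ a → 1` by the law of large numbers, so by Slutsky's theorem only the limit law of the
LePage series `∑ G_k ^ (-a) * ε_k` is needed. Given the arrival times, its partial sums have
characteristic function `∏ φ (t * G_k ^ (-a))`, where `φ` is the characteristic function of `ε_1`.
The generating functional of the Poisson process, `E ∏ h (G_k) = exp (-∫_0^∞ (1 - h))`, together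
with `∫_0^∞ (1 - φ (t * x ^ (-a))) dx = |t| ^ α * E |ε_1| ^ α / c_α`, turns the limit of its mean
into the stable characteristic function, and Lévy's continuity theorem concludes.

For the generating functional, `u x := exp (-∫_x^∞ (1 - h))` is the expected product over the points
beyond `x`, so `h (G_1) * ⋯ * h (G_n) * u (G_n)` has mean `u 0` for every `n`, while `u (G_n) → 1`.
-/

open Set Topology

section StableConst

lemma integrableOn_exp_neg_mul_cos {s : ℝ} (hs : 0 < s) (u : ℝ) :
    IntegrableOn (fun y : ℝ ↦ Real.exp (-(s * y)) * Real.cos (u * y)) (Ioi 0) := by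
  have hre : ((-s + u * Complex.I : ℂ)).re < 0 := by simpa
  simpa [Complex.exp_re] using! (integrableOn_exp_mul_complex_Ioi hre 0).re

lemma integral_exp_neg_mul_cos {s : ℝ} (hs : 0 < s) (u : ℝ) :
    ∫ y in Ioi (0 : ℝ), Real.exp (-(s * y)) * Real.cos (u * y) = s / (s ^ 2 + u ^ 2) := by
  have hre : ((-s + u * Complex.I : ℂ)).re < 0 := by simpa
  have h := integral_re (integrableOn_exp_mul_complex_Ioi hre 0)
  rw [integral_exp_mul_complex_Ioi hre] at h
  simpa [Complex.exp_re, Complex.div_re, Complex.normSq_apply, ← sq] using! h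

lemma integral_one_sub_cos_mul_exp_neg {s : ℝ} (hs : 0 < s) :
    ∫ y in Ioi (0 : ℝ), (1 - Real.cos y) * Real.exp (-(s * y)) = 1 / (s * (1 + s ^ 2)) := by
  have h := integral_sub (integrableOn_exp_neg_mul_cos hs 0) (integrableOn_exp_neg_mul_cos hs 1)
  rw [integral_exp_neg_mul_cos hs, integral_exp_neg_mul_cos hs] at h
  calc
    _ = s / (s ^ 2 + 0 ^ 2) - s / (s ^ 2 + 1 ^ 2) := by
      rw [← h]
      congr with y
      simp
      ring
    _ = 1 / (s * (1 + s ^ 2)) := by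
      field_simp
      ring

lemma lintegral_one_sub_cos_mul_exp_neg {s : ℝ} (hs : 0 < s) :
    ∫⁻ y in Ioi (0 : ℝ), ENNReal.ofReal ((1 - Real.cos y) * Real.exp (-(s * y))) =
      ENNReal.ofReal (1 / (s * (1 + s ^ 2))) := by
  rw [← integral_one_sub_cos_mul_exp_neg hs, ofReal_integral_eq_lintegral_ofReal]
  · have h := (integrableOn_exp_neg_mul_cos hs 0).sub (integrableOn_exp_neg_mul_cos hs 1)
    exact h.congr (ae_of_all _ fun y ↦ by simp; ring)
  · exact ae_of_all _ fun y ↦ mul_nonneg (sub_nonneg.2 (Real.cos_le_one y)) (Real.exp_pos _).le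

lemma lintegral_rpow_mul_exp_neg_mul_rpow {p q b : ℝ} (hp : 0 < p) (hq : -1 < q) (hb : 0 < b) :
    ∫⁻ x in Ioi (0 : ℝ), ENNReal.ofReal (x ^ q * Real.exp (-b * x ^ p)) =
      ENNReal.ofReal (b ^ (-(q + 1) / p) * (1 / p) * Real.Gamma ((q + 1) / p)) := by
  rw [← integral_rpow_mul_exp_neg_mul_rpow hp hq hb, ofReal_integral_eq_lintegral_ofReal]
  · exact integrableOn_rpow_mul_exp_neg_mul_rpow hq hp hb
  · filter_upwards [ae_restrict_mem measurableSet_Ioi] with x hx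
    exact mul_nonneg (Real.rpow_nonneg (le_of_lt hx) _) (Real.exp_pos _).le

lemma lintegral_rpow_mul_exp_neg_mul {q b : ℝ} (hq : -1 < q) (hb : 0 < b) :
    ∫⁻ x in Ioi (0 : ℝ), ENNReal.ofReal (x ^ q * Real.exp (-(b * x))) =
      ENNReal.ofReal (b ^ (-(q + 1)) * Real.Gamma (q + 1)) := by
  simpa using lintegral_rpow_mul_exp_neg_mul_rpow one_pos hq hb

variable {α : ℝ}

-- Tonelli, after writing `1 / (1 + s ^ 2)` as the integral of `u ↦ exp (-u * (1 + s ^ 2))`.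
lemma lintegral_rpow_div_one_add_sq (h0 : 0 < α) (h2 : α < 2) :
    ∫⁻ s in Ioi (0 : ℝ), ENNReal.ofReal (s ^ (α - 1) / (1 + s ^ 2)) =
      ENNReal.ofReal (Real.pi / (2 * Real.sin (Real.pi * α / 2))) := by
  have := Real.Gamma_pos_of_pos (half_pos h0)
  have integral_u : ∀ s ∈ Ioi (0 : ℝ), ENNReal.ofReal (s ^ (α - 1) / (1 + s ^ 2)) =
      ∫⁻ u in Ioi (0 : ℝ), ENNReal.ofReal (s ^ (α - 1) * Real.exp (-((1 + s ^ 2) * u))) := by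
    intro s (hs : 0 < s)
    have h := lintegral_rpow_mul_exp_neg_mul (q := 0) (b := 1 + s ^ 2) (by simp) (by positivity)
    simp only [Real.rpow_zero, one_mul, zero_add, Real.Gamma_one, mul_one, Real.rpow_neg_one] at h
    simp_rw [ENNReal.ofReal_mul (Real.rpow_nonneg hs.le (α - 1))]
    rw [lintegral_const_mul _ (by fun_prop), h, div_eq_mul_inv, ENNReal.ofReal_mul (by positivity)]
  have integral_s : ∀ u ∈ Ioi (0 : ℝ),
      ∫⁻ s in Ioi (0 : ℝ), ENNReal.ofReal (s ^ (α - 1) * Real.exp (-((1 + s ^ 2) * u))) =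
        ENNReal.ofReal (Real.Gamma (α / 2) / 2) *
          ENNReal.ofReal (u ^ (-(α / 2)) * Real.exp (-(1 * u))) := by
    intro u (hu : 0 < u)
    have h := lintegral_rpow_mul_exp_neg_mul_rpow two_pos (show -1 < α - 1 by linarith) hu
    have hexp (s : ℝ) : s ^ (α - 1) * Real.exp (-((1 + s ^ 2) * u)) =
        Real.exp (-u) * (s ^ (α - 1) * Real.exp (-u * s ^ (2 : ℝ))) := by
      rw [Real.rpow_two, mul_left_comm, ← Real.exp_add]
      ring_nf
    simp_rw [hexp, ENNReal.ofReal_mul (Real.exp_pos (-u)).le]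
    rw [lintegral_const_mul _ (by fun_prop), h, ← ENNReal.ofReal_mul (by positivity),
      ← ENNReal.ofReal_mul (by positivity)]
    ring_nf
  rw [setLIntegral_congr_fun measurableSet_Ioi integral_u, lintegral_lintegral_swap (by fun_prop),
    setLIntegral_congr_fun measurableSet_Ioi integral_s, lintegral_const_mul _ (by fun_prop),
    lintegral_rpow_mul_exp_neg_mul (by linarith) one_pos, ← ENNReal.ofReal_mul (by positivity)]
  congr 1
  calc
    _ = Real.Gamma (α / 2) * Real.Gamma (1 - α / 2) / 2 := by
      rw [Real.one_rpow]
      ring_nf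
    _ = Real.pi / (2 * Real.sin (Real.pi * α / 2)) := by
      rw [Real.Gamma_mul_Gamma_one_sub, ← mul_div_assoc, div_div, mul_comm 2]

lemma sin_pi_mul_div_two_pos (h0 : 0 < α) (h2 : α < 2) : 0 < Real.sin (Real.pi * α / 2) := by
  apply Real.sin_pos_of_pos_of_lt_pi <;> nlinarith [Real.pi_pos]

lemma cos_pi_mul_div_two_ne_zero (h0 : 0 < α) (h2 : α < 2) (h1 : α ≠ 1) :
    Real.cos (Real.pi * α / 2) ≠ 0 := by
  rw [← Real.sin_pi_div_two_sub, Ne, Real.sin_eq_zero_iff_of_lt_of_lt]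
  · intro h
    have hπ : Real.pi * (α - 1) = 0 := by linear_combination -2 * h
    simp [Real.pi_ne_zero, sub_eq_zero, h1] at hπ
  all_goals nlinarith [Real.pi_pos]

lemma inv_stableConst (h0 : 0 < α) (h2 : α < 2) :
    (stableConst α)⁻¹ = Real.pi / (2 * Real.Gamma α * Real.sin (Real.pi * α / 2)) := by
  rw [stableConst]
  split_ifs with h1
  · simp [h1]
  have hα : 1 - α ≠ 0 := sub_ne_zero.2 (Ne.symm h1)
  have := Real.Gamma_pos_of_pos h0
  have hsin := sin_pi_mul_div_two_pos h0 h2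
  have hcos := cos_pi_mul_div_two_ne_zero h0 h2 h1
  have functional_eq : Real.Gamma (2 - α) = (1 - α) * Real.Gamma (1 - α) := by
    rw [← Real.Gamma_add_one hα]
    ring_nf
  have double_angle : Real.sin (Real.pi * α) =
      2 * Real.sin (Real.pi * α / 2) * Real.cos (Real.pi * α / 2) := by
    rw [← Real.sin_two_mul]
    ring_nf
  have reflection := Real.Gamma_mul_Gamma_one_sub α
  rw [double_angle, eq_div_iff (by positivity)] at reflection
  rw [functional_eq, inv_div, div_eq_div_iff hα (by positivity)]
  linear_combination (1 - α) * reflection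

lemma stableConst_pos (h0 : 0 < α) (h2 : α < 2) : 0 < stableConst α := by
  have := Real.Gamma_pos_of_pos h0
  have hsin := sin_pi_mul_div_two_pos h0 h2
  rw [← inv_pos, inv_stableConst h0 h2]
  positivity

-- Tonelli, after writing `y ^ (-α - 1)` as a Gamma integral of `s ↦ exp (-(y * s))`.
lemma lintegral_rpow_mul_one_sub_cos (h0 : 0 < α) (h2 : α < 2) :
    ∫⁻ y in Ioi (0 : ℝ), ENNReal.ofReal (α * y ^ (-α - 1) * (1 - Real.cos y)) =
      ENNReal.ofReal (stableConst α)⁻¹ := by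
  have := Real.Gamma_pos_of_pos h0
  have hcos (y : ℝ) : 0 ≤ 1 - Real.cos y := sub_nonneg.2 (Real.cos_le_one y)
  have integral_s : ∀ y ∈ Ioi (0 : ℝ), ENNReal.ofReal (α * y ^ (-α - 1) * (1 - Real.cos y)) =
      ∫⁻ s in Ioi (0 : ℝ), ENNReal.ofReal
        ((Real.Gamma α)⁻¹ * (1 - Real.cos y) * (s ^ α * Real.exp (-(y * s)))) := by
    intro y (hy : 0 < y)
    have := hcos y
    simp_rw [ENNReal.ofReal_mul (show 0 ≤ (Real.Gamma α)⁻¹ * (1 - Real.cos y) by positivity)]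
    rw [lintegral_const_mul _ (by fun_prop), lintegral_rpow_mul_exp_neg_mul (by linarith) hy,
      ← ENNReal.ofReal_mul (by positivity), Real.Gamma_add_one h0.ne', neg_add']
    field_simp
  have integral_y : ∀ s ∈ Ioi (0 : ℝ), ∫⁻ y in Ioi (0 : ℝ), ENNReal.ofReal
        ((Real.Gamma α)⁻¹ * (1 - Real.cos y) * (s ^ α * Real.exp (-(y * s)))) =
      ENNReal.ofReal (Real.Gamma α)⁻¹ * ENNReal.ofReal (s ^ (α - 1) / (1 + s ^ 2)) := by
    intro s (hs : 0 < s)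
    have hcomm (y : ℝ) : (Real.Gamma α)⁻¹ * (1 - Real.cos y) * (s ^ α * Real.exp (-(y * s))) =
        (Real.Gamma α)⁻¹ * s ^ α * ((1 - Real.cos y) * Real.exp (-(s * y))) := by
      ring_nf
    simp_rw [hcomm, ENNReal.ofReal_mul (show 0 ≤ (Real.Gamma α)⁻¹ * s ^ α by positivity)]
    rw [lintegral_const_mul _ (by fun_prop), lintegral_one_sub_cos_mul_exp_neg hs,
      ← ENNReal.ofReal_mul (by positivity), ← ENNReal.ofReal_mul (by positivity),
      Real.rpow_sub_one hs.ne']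
    field_simp
  rw [setLIntegral_congr_fun measurableSet_Ioi integral_s, lintegral_lintegral_swap (by fun_prop),
    setLIntegral_congr_fun measurableSet_Ioi integral_y, lintegral_const_mul _ (by fun_prop),
    lintegral_rpow_div_one_add_sq h0 h2, ← ENNReal.ofReal_mul (by positivity),
    inv_stableConst h0 h2]
  field_simp

lemma rpow_mul_one_sub_cos_nonneg_ae (h0 : 0 < α) :
    0 ≤ᵐ[volume.restrict (Ioi 0)] fun y : ℝ ↦ α * y ^ (-α - 1) * (1 - Real.cos y) :=
  ae_restrict_of_forall_mem measurableSet_Ioi fun y (hy : 0 < y) ↦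
    mul_nonneg (by positivity) (sub_nonneg.2 (Real.cos_le_one y))

lemma integrableOn_rpow_mul_one_sub_cos (h0 : 0 < α) (h2 : α < 2) :
    IntegrableOn (fun y : ℝ ↦ α * y ^ (-α - 1) * (1 - Real.cos y)) (Ioi 0) := by
  refine ⟨by fun_prop, ?_⟩
  rw [hasFiniteIntegral_iff_ofReal (rpow_mul_one_sub_cos_nonneg_ae h0),
    lintegral_rpow_mul_one_sub_cos h0 h2]
  exact ENNReal.ofReal_lt_top

lemma integral_rpow_mul_one_sub_cos (h0 : 0 < α) (h2 : α < 2) :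
    ∫ y in Ioi (0 : ℝ), α * y ^ (-α - 1) * (1 - Real.cos y) = (stableConst α)⁻¹ := by
  rw [integral_eq_lintegral_of_nonneg_ae (rpow_mul_one_sub_cos_nonneg_ae h0) (by fun_prop),
    lintegral_rpow_mul_one_sub_cos h0 h2,
    ENNReal.toReal_ofReal (inv_nonneg.2 (stableConst_pos h0 h2).le)]

lemma rpow_mul_one_sub_cos_mul_rpow_rpow (h0 : 0 < α) {c y : ℝ} (hc : c ≠ 0) (hy : 0 < y) :
    |-α| * y ^ (-α - 1) * (1 - Real.cos (c * (y ^ (-α)) ^ (-α⁻¹))) =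
      |c| ^ α * |c| * (α * (|c| * y) ^ (-α - 1) * (1 - Real.cos (|c| * y))) := by
  have hc0 : 0 < |c| := abs_pos.2 hc
  have hroot : (y ^ (-α)) ^ (-α⁻¹) = y := by
    rw [← Real.rpow_mul hy.le, neg_mul_neg, mul_inv_cancel₀ h0.ne', Real.rpow_one]
  have heven : Real.cos (c * y) = Real.cos (|c| * y) := by
    rw [← Real.cos_abs, abs_mul, abs_of_pos hy]
  have hpow : |c| ^ (-α - 1) * (|c| ^ α * |c|) = 1 := by
    rw [← Real.rpow_add_one hc0.ne', ← Real.rpow_add hc0]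
    simp
  rw [hroot, heven, abs_neg, abs_of_pos h0, Real.mul_rpow hc0.le hy.le]
  linear_combination (-(α * y ^ (-α - 1) * (1 - Real.cos (|c| * y)))) * hpow

lemma integrableOn_one_sub_cos_mul_rpow (h0 : 0 < α) (h2 : α < 2) (c : ℝ) :
    IntegrableOn (fun x : ℝ ↦ 1 - Real.cos (c * x ^ (-α⁻¹))) (Ioi 0) := by
  rcases eq_or_ne c 0 with rfl | hc
  · simp
  rw [← integrableOn_Ioi_comp_rpow_iff _ (neg_ne_zero.2 h0.ne')]
  simp only [smul_eq_mul]
  refine IntegrableOn.congr_fun (Integrable.const_mul ?_ _)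
    (fun y hy ↦ (rpow_mul_one_sub_cos_mul_rpow_rpow h0 hc hy).symm) measurableSet_Ioi
  refine (integrableOn_Ioi_comp_mul_left_iff
    (fun y ↦ α * y ^ (-α - 1) * (1 - Real.cos y)) 0 (abs_pos.2 hc)).2 ?_
  simpa only [mul_zero] using integrableOn_rpow_mul_one_sub_cos h0 h2

lemma integral_one_sub_cos_mul_rpow (h0 : 0 < α) (h2 : α < 2) (c : ℝ) :
    ∫ x in Ioi (0 : ℝ), (1 - Real.cos (c * x ^ (-α⁻¹))) = |c| ^ α / stableConst α := by
  rcases eq_or_ne c 0 with rfl | hc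
  · simp [Real.zero_rpow h0.ne']
  have hc0 : 0 < |c| := abs_pos.2 hc
  rw [← integral_comp_rpow_Ioi _ (neg_ne_zero.2 h0.ne')]
  simp only [smul_eq_mul]
  rw [setIntegral_congr_fun measurableSet_Ioi
      fun y hy ↦ rpow_mul_one_sub_cos_mul_rpow_rpow h0 hc hy,
    integral_const_mul,
    integral_comp_mul_left_Ioi (fun y ↦ α * y ^ (-α - 1) * (1 - Real.cos y)) 0 hc0,
    mul_zero, integral_rpow_mul_one_sub_cos h0 h2, smul_eq_mul]
  field_simp

end StableConst

section ExpMeasure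

variable {r : ℝ}

lemma expMeasure_eq_withDensity_restrict (r : ℝ) :
    expMeasure r = (volume.restrict (Ioi 0)).withDensity
      fun y ↦ ENNReal.ofReal (r * Real.exp (-(r * y))) := by
  rw [Measure.restrict_congr_set Ioi_ae_eq_Ici, ← withDensity_indicator measurableSet_Ici]
  change volume.withDensity (exponentialPDF r) = _
  congr with y
  simp only [exponentialPDF_eq, indicator_apply, mem_Ici]
  split_ifs <;> simp

lemma expMeasure_absolutelyContinuous (r : ℝ) : expMeasure r ≪ volume.restrict (Ioi 0) := by
  rw [expMeasure_eq_withDensity_restrict]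
  exact withDensity_absolutelyContinuous _ _

lemma ae_pos_expMeasure (r : ℝ) : ∀ᵐ y ∂(expMeasure r), 0 < y :=
  (expMeasure_absolutelyContinuous r).ae_le (ae_restrict_mem measurableSet_Ioi)

variable {E : Type*} [NormedAddCommGroup E] [NormedSpace ℝ E]

lemma integral_expMeasure (hr : 0 < r) (f : ℝ → E) :
    ∫ y, f y ∂(expMeasure r) = ∫ y in Ioi (0 : ℝ), (r * Real.exp (-(r * y))) • f y := by
  rw [expMeasure_eq_withDensity_restrict, integral_withDensity_eq_integral_toReal_smul
    (by fun_prop) (ae_of_all _ fun _ ↦ ENNReal.ofReal_lt_top)]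
  congr with y
  rw [ENNReal.toReal_ofReal (by positivity)]

lemma integrable_expMeasure_iff (hr : 0 < r) {f : ℝ → E} :
    Integrable f (expMeasure r) ↔
      IntegrableOn (fun y ↦ (r * Real.exp (-(r * y))) • f y) (Ioi 0) := by
  rw [expMeasure_eq_withDensity_restrict, integrable_withDensity_iff_integrable_smul'
    (by fun_prop) (ae_of_all _ fun _ ↦ ENNReal.ofReal_lt_top), IntegrableOn]
  congr! with y
  rw [ENNReal.toReal_ofReal (by positivity)]

lemma integrable_id_expMeasure (hr : 0 < r) : Integrable id (expMeasure r) := by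
  rw [integrable_expMeasure_iff hr]
  have h := integrableOn_rpow_mul_exp_neg_mul_rpow (s := 1) (by norm_num) one_pos hr
  refine (h.const_mul r).congr (ae_of_all _ fun y ↦ ?_)
  simp [mul_assoc, mul_comm y]

lemma integral_id_expMeasure (hr : 0 < r) : ∫ y, y ∂(expMeasure r) = r⁻¹ := by
  have h := Real.integral_rpow_mul_exp_neg_mul_Ioi two_pos hr
  have hy (y : ℝ) : (r * Real.exp (-(r * y))) • y =
      r * (y ^ ((2 : ℝ) - 1) * Real.exp (-(r * y))) := by
    norm_num
    ring
  simp_rw [integral_expMeasure hr, hy]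
  rw [integral_const_mul, h]
  simp
  field_simp

end ExpMeasure

section HasDerivAtIntegralIoi

variable {E : Type*} [NormedAddCommGroup E] [NormedSpace ℝ E] [CompleteSpace E]

lemma hasDerivAt_integral_Ioi {f : ℝ → E} {a x : ℝ} (hf : IntegrableOn f (Ioi a))
    (hc : ContinuousOn f (Ioi a)) (hx : a < x) :
    HasDerivAt (fun y ↦ ∫ z in Ioi y, f z) (-f x) x := by
  have hint : IntervalIntegrable f volume a x :=
    (intervalIntegrable_iff_integrableOn_Ioc_of_le hx.le).2 (hf.mono_set Ioc_subset_Ioi_self)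
  have hprim := intervalIntegral.integral_hasDerivAt_right hint
    (hc.stronglyMeasurableAtFilter isOpen_Ioi x hx) (hc.continuousAt (Ioi_mem_nhds hx))
  refine (hprim.const_sub (∫ z in Ioi a, f z)).congr_of_eventuallyEq ?_
  filter_upwards [Ioi_mem_nhds hx] with y hy
  rw [← intervalIntegral.integral_Ioi_sub_Ioi hf (le_of_lt hy), sub_sub_cancel]

end HasDerivAtIntegralIoi

/-- The generating functional `E ∏ h (T)` over the points `T > x` of a Poisson process of
intensity `r`, defined by its closed form. -/
noncomputable def tailWeight (r : ℝ) (h : ℝ → ℂ) (x : ℝ) : ℂ :=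
  Complex.exp (-(r * ∫ z in Ioi x, (1 - h z)))

namespace tailWeight

variable {r : ℝ} {h : ℝ → ℂ} {x : ℝ}

lemma norm_le_one (hr : 0 ≤ r) (h1 : ∀ x, ‖h x‖ ≤ 1) (x : ℝ) : ‖tailWeight r h x‖ ≤ 1 := by
  have hre : 0 ≤ (∫ z in Ioi x, (1 - h z)).re := by
    by_cases hi : IntegrableOn (fun z ↦ 1 - h z) (Ioi x)
    · rw [← RCLike.re_to_complex, ← integral_re hi]
      exact integral_nonneg fun z ↦ by simpa using (Complex.re_le_norm _).trans (h1 z)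
    · simp [integral_undef hi]
  rw [tailWeight, Complex.norm_exp, Complex.neg_re, Complex.re_ofReal_mul, Real.exp_le_one_iff]
  exact neg_nonpos.2 (mul_nonneg hr hre)

@[fun_prop]
lemma measurable (hm : Measurable h) : Measurable (tailWeight r h) := by
  have hI : Measurable fun x ↦ ∫ z in Ioi x, (1 - h z) := by
    simp_rw [← integral_indicator measurableSet_Ioi]
    have : Measurable fun p : ℝ × ℝ ↦ (Ioi p.1).indicator (fun z ↦ 1 - h z) p.2 := by
      have hs : MeasurableSet {p : ℝ × ℝ | p.1 < p.2} :=
        measurableSet_lt measurable_fst measurable_snd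
      exact (show Measurable fun p : ℝ × ℝ ↦ 1 - h p.2 by fun_prop).indicator hs
    exact this.stronglyMeasurable.integral_prod_right.measurable
  unfold tailWeight
  fun_prop

lemma tendsto_atTop : Tendsto (tailWeight r h) atTop (𝓝 1) := by
  have h0 := tendsto_integral_Ioi_zero (f := fun z ↦ 1 - h z) (μ := volume) tendsto_id
  simpa [tailWeight] using! (h0.const_mul (r : ℂ)).neg.cexp

variable (hi : IntegrableOn (fun x ↦ 1 - h x) (Ioi 0))
include hi

lemma continuousOn : ContinuousOn (tailWeight r h) (Ici 0) :=
  (hi.continuousOn_Ici_primitive_Ioi.const_mul (r : ℂ)).neg.cexp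

variable (hc : ContinuousOn h (Ioi 0))
include hc

lemma hasDerivAt (hx : 0 < x) :
    HasDerivAt (tailWeight r h) (r * (1 - h x) * tailWeight r h x) x := by
  have hprim := hasDerivAt_integral_Ioi hi (by fun_prop) hx
  refine ((hprim.const_mul (r : ℂ)).neg.cexp).congr_deriv ?_
  simp only [tailWeight, Pi.neg_apply]
  ring

lemma hasDerivAt_exp_neg_mul_comp_add (hx : 0 ≤ x) {y : ℝ} (hy : 0 < y) :
    HasDerivAt (fun y ↦ -(Real.exp (-(r * y)) • tailWeight r h (x + y)))
      ((r * Real.exp (-(r * y))) • (h (x + y) * tailWeight r h (x + y))) y := by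
  have hexp : HasDerivAt (fun y ↦ Real.exp (-(r * y))) (Real.exp (-(r * y)) * -(r * 1)) y :=
    ((hasDerivAt_id y).const_mul r).neg.exp
  have hT := (hasDerivAt (r := r) hi hc (add_pos_of_nonneg_of_pos hx hy)).comp_const_add x y
  refine (hexp.smul hT).neg.congr_deriv ?_
  simp only [Complex.real_smul, Complex.ofReal_mul, Complex.ofReal_neg, Complex.ofReal_one]
  ring

-- `tailWeight` is harmonic for the walk with exponential steps: the integrand is the derivative
-- of `-exp (-r y) * tailWeight (x + y)`.
lemma integral_comp_add_expMeasure (hr : 0 < r) (hm : Measurable h) (h1 : ∀ x, ‖h x‖ ≤ 1)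
    (hx : 0 ≤ x) :
    ∫ y, h (x + y) * tailWeight r h (x + y) ∂(expMeasure r) = tailWeight r h x := by
  have : IsProbabilityMeasure (expMeasure r) := isProbabilityMeasure_expMeasure hr
  have hint : Integrable (fun y ↦ h (x + y) * tailWeight r h (x + y)) (expMeasure r) := by
    refine .of_bound (C := 1) (by fun_prop) (ae_of_all _ fun y ↦ ?_)
    exact (norm_mul_le _ _).trans
      (mul_le_one₀ (h1 _) (norm_nonneg _) (norm_le_one hr.le h1 _))
  have hcont : ContinuousWithinAt (fun y ↦ -(Real.exp (-(r * y)) • tailWeight r h (x + y)))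
      (Ici 0) 0 := by
    have hT : ContinuousOn (fun y ↦ tailWeight r h (x + y)) (Ici 0) :=
      (continuousOn hi).comp (by fun_prop) fun y (hy : 0 ≤ y) ↦ add_nonneg hx hy
    have hexp : ContinuousOn (fun y ↦ Real.exp (-(r * y))) (Ici 0) := by fun_prop
    exact (hexp.smul hT).neg 0 self_mem_Ici
  have hlim : Tendsto (fun y ↦ -(Real.exp (-(r * y)) • tailWeight r h (x + y))) atTop (𝓝 0) := by
    have hexp := Real.tendsto_exp_neg_atTop_nhds_zero.comp (tendsto_id.const_mul_atTop hr)
    simpa using! (hexp.smul (tendsto_atTop.comp (tendsto_atTop_add_const_left _ x tendsto_id))).neg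
  rw [integral_expMeasure hr, integral_Ioi_of_hasDerivAt_of_tendsto hcont
    (fun y hy ↦ hasDerivAt_exp_neg_mul_comp_add hi hc hx hy)
    ((integrable_expMeasure_iff hr).1 hint) hlim]
  simp

end tailWeight

section Independence

variable {Ω : Type*} [MeasurableSpace Ω] {P : Measure Ω}

lemma integral_comp_prodMk_of_indepFun {E F V : Type*} [MeasurableSpace E] [MeasurableSpace F]
    [NormedAddCommGroup V] [NormedSpace ℝ V] [IsFiniteMeasure P] {X : Ω → E} {Y : Ω → F}
    (hXY : IndepFun X Y P) (hX : AEMeasurable X P) (hY : AEMeasurable Y P) {f : E × F → V}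
    (hf : StronglyMeasurable f) (hint : Integrable (fun ω ↦ f (X ω, Y ω)) P) :
    ∫ ω, f (X ω, Y ω) ∂P = ∫ ω, ∫ ω', f (X ω, Y ω') ∂P ∂P := by
  have hprod := (indepFun_iff_map_prod_eq_prod_map_map hX hY).1 hXY
  have hf_int : Integrable f ((P.map X).prod (P.map Y)) := by
    rw [← hprod, integrable_map_measure hf.aestronglyMeasurable (hX.prodMk hY)]
    exact hint
  calc
    _ = ∫ p, f p ∂(P.map fun ω ↦ (X ω, Y ω)) :=
      (integral_map (hX.prodMk hY) hf.aestronglyMeasurable).symm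
    _ = ∫ x, ∫ y, f (x, y) ∂(P.map Y) ∂(P.map X) := by rw [hprod, integral_prod _ hf_int]
    _ = ∫ ω, ∫ y, f (X ω, y) ∂(P.map Y) ∂P :=
      integral_map hX hf.integral_prod_right'.aestronglyMeasurable
    _ = _ := by
      congr with ω
      exact integral_map hY (hf.comp_measurable measurable_prodMk_left).aestronglyMeasurable

lemma indepFun_zero_succ {E : Type*} [MeasurableSpace E] {ξ : ℕ → Ω → E} (hξ : iIndepFun ξ P)
    (hm : ∀ n, AEMeasurable (ξ n) P) : IndepFun (ξ 0) (fun ω n ↦ ξ (n + 1) ω) P := by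
  have := hξ.isProbabilityMeasure
  refine IndepFun.indepFun_process₀ (hm 0) (fun n ↦ hm (n + 1)) fun I ↦ ?_
  have h := hξ.indepFun_finset₀ {0} (I.map ⟨_, Nat.succ_injective⟩) (by simp) hm
  let J : Finset ℕ := I.map ⟨_, Nat.succ_injective⟩
  have hφ : Measurable fun v : ({0} : Finset ℕ) → E ↦ v ⟨0, by simp⟩ := measurable_pi_apply _
  have hψ : Measurable fun (v : J → E) (i : I) ↦ v ⟨i + 1, by simp [J]⟩ :=
    measurable_pi_lambda _ fun _ ↦ measurable_pi_apply _
  exact h.comp hφ hψ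

end Independence

/-- For the walk started at `x` with steps `s 0, s 1, …`: the product of `h` over the first `n`
positions, completed by the expected contribution `tailWeight` of the later ones. -/
noncomputable def tailCompletedProd (r : ℝ) (h : ℝ → ℂ) (n : ℕ) (x : ℝ) (s : ℕ → ℝ) : ℂ :=
  (∏ k ∈ Finset.range n, h (x + ∑ j ∈ Finset.range (k + 1), s j)) *
    tailWeight r h (x + ∑ j ∈ Finset.range n, s j)

lemma norm_prod_le_one {ι : Type*} (s : Finset ι) {f : ι → ℂ} (hf : ∀ i ∈ s, ‖f i‖ ≤ 1) :
    ‖∏ i ∈ s, f i‖ ≤ 1 := by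
  rw [norm_prod]
  exact Finset.prod_le_one (fun _ _ ↦ norm_nonneg _) hf

namespace tailCompletedProd

variable {r : ℝ} {h : ℝ → ℂ} {x : ℝ}

lemma succ (r : ℝ) (h : ℝ → ℂ) (n : ℕ) (x : ℝ) (s : ℕ → ℝ) :
    tailCompletedProd r h (n + 1) x s =
      h (x + s 0) * tailCompletedProd r h n (x + s 0) (fun i ↦ s (i + 1)) := by
  have hsum (k : ℕ) : x + ∑ j ∈ Finset.range (k + 1), s j =
      x + s 0 + ∑ j ∈ Finset.range k, s (j + 1) := by
    rw [Finset.sum_range_succ', add_assoc, add_comm (s 0)]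
  simp only [tailCompletedProd, hsum, Finset.prod_range_succ', Finset.range_zero, Finset.sum_empty,
    add_zero]
  ring

lemma norm_le_one (hr : 0 ≤ r) (h1 : ∀ x, ‖h x‖ ≤ 1) (n : ℕ) (x : ℝ) (s : ℕ → ℝ) :
    ‖tailCompletedProd r h n x s‖ ≤ 1 :=
  (norm_mul_le _ _).trans <| mul_le_one₀ (norm_prod_le_one _ fun _ _ ↦ h1 _) (norm_nonneg _)
    (tailWeight.norm_le_one hr h1 _)

end tailCompletedProd

section WaitingTimes

variable {Ω : Type*} [MeasurableSpace Ω] {P : Measure Ω} {r : ℝ}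

lemma ae_pos_of_hasLaw_expMeasure {X : Ω → ℝ} (hX : HasLaw X (expMeasure r) P) :
    ∀ᵐ ω ∂P, 0 < X ω :=
  (hX.ae_iff (p := fun y ↦ 0 < y) (measurableSet_setOfPred.1 measurableSet_Ioi)).2
    (ae_pos_expMeasure r)

variable {ξ : ℕ → Ω → ℝ}

lemma ae_tendsto_sum_div_of_hasLaw_expMeasure (hr : 0 < r) (hind : iIndepFun ξ P)
    (hlaw : ∀ n, HasLaw (ξ n) (expMeasure r) P) :
    ∀ᵐ ω ∂P, Tendsto (fun n : ℕ ↦ (∑ j ∈ Finset.range n, ξ j ω) / n) atTop (𝓝 r⁻¹) := by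
  have hint : Integrable (ξ 0) P := by
    have h := integrable_id_expMeasure hr
    rw [← (hlaw 0).map_eq] at h
    exact h.comp_aemeasurable (hlaw 0).aemeasurable
  have hmean : ∫ ω, ξ 0 ω ∂P = r⁻¹ := by
    rw [← integral_id_expMeasure hr, ← (hlaw 0).integral_comp (by fun_prop)]
    rfl
  rw [← hmean]
  exact strong_law_ae_real ξ hint (fun i j hij ↦ hind.indepFun hij)
    fun i ↦ (hlaw i).identDistrib (hlaw 0)

variable {h : ℝ → ℂ}

-- Conditioning on the first step turns the identity for `n` steps into the one for `n + 1`
-- steps, by the harmonicity of `tailWeight`.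
lemma integral_tailCompletedProd (hr : 0 < r) (hind : iIndepFun ξ P)
    (hlaw : ∀ n, HasLaw (ξ n) (expMeasure r) P) (hm : Measurable h)
    (hi : IntegrableOn (fun x ↦ 1 - h x) (Ioi 0)) (h1 : ∀ x, ‖h x‖ ≤ 1)
    (hc : ContinuousOn h (Ioi 0)) (n : ℕ) {x : ℝ} (hx : 0 ≤ x) :
    ∫ ω, tailCompletedProd r h n x (ξ · ω) ∂P = tailWeight r h x := by
  have := hind.isProbabilityMeasure
  induction n generalizing ξ x with
  | zero => simp [tailCompletedProd]
  | succ n ih =>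
    let f : ℝ × (ℕ → ℝ) → ℂ := fun p ↦ h (x + p.1) * tailCompletedProd r h n (x + p.1) p.2
    have hf : Measurable f := by
      simp only [f, tailCompletedProd]
      fun_prop
    have hξ (n : ℕ) : AEMeasurable (ξ n) P := (hlaw n).aemeasurable
    have hint : Integrable (fun ω ↦ f (ξ 0 ω, fun i ↦ ξ (i + 1) ω)) P := by
      refine .of_bound (C := 1) (hf.comp_aemeasurable (by fun_prop)).aestronglyMeasurable
        (ae_of_all _ fun ω ↦ ?_)
      exact (norm_mul_le _ _).trans
        (mul_le_one₀ (h1 _) (norm_nonneg _) (tailCompletedProd.norm_le_one hr.le h1 _ _ _))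
    calc
      _ = ∫ ω, f (ξ 0 ω, fun i ↦ ξ (i + 1) ω) ∂P := by
        simp_rw [tailCompletedProd.succ, f]
      _ = ∫ ω, h (x + ξ 0 ω) *
            ∫ ω', tailCompletedProd r h n (x + ξ 0 ω) (fun i ↦ ξ (i + 1) ω') ∂P ∂P := by
        rw [integral_comp_prodMk_of_indepFun (indepFun_zero_succ hind hξ) (hξ 0) (by fun_prop)
          hf.stronglyMeasurable hint]
        simp_rw [f, integral_const_mul]
      _ = ∫ ω, h (x + ξ 0 ω) * tailWeight r h (x + ξ 0 ω) ∂P := by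
        refine integral_congr_ae ?_
        filter_upwards [ae_pos_of_hasLaw_expMeasure (hlaw 0)] with ω hω
        rw [ih (hind.precomp Nat.succ_injective) (fun n ↦ hlaw (n + 1)) (by positivity)]
      _ = ∫ y, h (x + y) * tailWeight r h (x + y) ∂(expMeasure r) :=
        (hlaw 0).integral_comp (f := fun y ↦ h (x + y) * tailWeight r h (x + y)) (by fun_prop)
      _ = tailWeight r h x := tailWeight.integral_comp_add_expMeasure hi hc hr hm h1 hx

end WaitingTimes

lemma sum_interarrival {Ω : Type*} (G : ℕ → Ω → ℝ) (n : ℕ) (ω : Ω) :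
    ∑ j ∈ Finset.range (n + 1), interarrival G j ω = G (n + 1) ω := by
  induction n with
  | zero => simp [interarrival]
  | succ n ih => rw [Finset.sum_range_succ, ih, interarrival, add_sub_cancel]

namespace IsPoissonArrivalTimes

variable {Ω : Type*} [MeasurableSpace Ω] {P : Measure Ω} {r : ℝ} {G : ℕ → Ω → ℝ}

variable (hG : IsPoissonArrivalTimes r G P)
include hG

lemma aemeasurable (n : ℕ) : AEMeasurable (G (n + 1)) P := by
  have := fun j ↦ (hG.law j).aemeasurable
  refine AEMeasurable.congr (f := fun ω ↦ ∑ j ∈ Finset.range (n + 1), interarrival G j ω)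
    (by fun_prop) (ae_of_all _ (sum_interarrival G n))

lemma ae_forall_pos : ∀ᵐ ω ∂P, ∀ n, 0 < G (n + 1) ω := by
  filter_upwards [ae_all_iff.2 fun n ↦ ae_pos_of_hasLaw_expMeasure (hG.law n)] with ω hω n
  rw [← sum_interarrival G n ω]
  exact Finset.sum_pos (fun j _ ↦ hω j) ⟨0, by simp⟩

lemma ae_tendsto_div (hr : 0 < r) :
    ∀ᵐ ω ∂P, Tendsto (fun n : ℕ ↦ G n ω / n) atTop (𝓝 r⁻¹) := by
  filter_upwards [ae_tendsto_sum_div_of_hasLaw_expMeasure hr hG.indep hG.law] with ω hω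
  rw [← tendsto_add_atTop_iff_nat 1] at hω ⊢
  simpa only [sum_interarrival] using hω

lemma ae_tendsto_atTop (hr : 0 < r) : ∀ᵐ ω ∂P, Tendsto (fun n ↦ G n ω) atTop atTop := by
  filter_upwards [hG.ae_tendsto_div hr] with ω hω
  refine (hω.pos_mul_atTop (inv_pos.2 hr) tendsto_natCast_atTop_atTop).congr' ?_
  filter_upwards [eventually_ne_atTop 0] with n hn
  exact div_mul_cancel₀ _ (Nat.cast_ne_zero.2 hn)

variable {h : ℝ → ℂ}

lemma integral_prod_mul_tailWeight (hr : 0 < r) (hm : Measurable h)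
    (hi : IntegrableOn (fun x ↦ 1 - h x) (Ioi 0)) (h1 : ∀ x, ‖h x‖ ≤ 1)
    (hc : ContinuousOn h (Ioi 0)) (n : ℕ) :
    ∫ ω, (∏ k ∈ Finset.range (n + 1), h (G (k + 1) ω)) * tailWeight r h (G (n + 1) ω) ∂P =
      tailWeight r h 0 := by
  rw [← integral_tailCompletedProd hr hG.indep hG.law hm hi h1 hc (n + 1) le_rfl]
  simp only [tailCompletedProd, zero_add, sum_interarrival]

lemma tendsto_integral_prod (hr : 0 < r) (hm : Measurable h)
    (hi : IntegrableOn (fun x ↦ 1 - h x) (Ioi 0)) (h1 : ∀ x, ‖h x‖ ≤ 1)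
    (hc : ContinuousOn h (Ioi 0)) :
    Tendsto (fun n ↦ ∫ ω, ∏ k ∈ Finset.range n, h (G (k + 1) ω) ∂P) atTop
      (𝓝 (Complex.exp (-(r * ∫ x in Ioi 0, (1 - h x))))) := by
  have := hG.indep.isProbabilityMeasure
  have hGm := hG.aemeasurable
  let Q (n : ℕ) (ω : Ω) : ℂ := ∏ k ∈ Finset.range (n + 1), h (G (k + 1) ω)
  let T (n : ℕ) (ω : Ω) : ℂ := tailWeight r h (G (n + 1) ω)
  have hQm (n : ℕ) : AEStronglyMeasurable (Q n) P := by fun_prop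
  have hTm (n : ℕ) : AEStronglyMeasurable (T n) P := by fun_prop
  have hQ (n : ℕ) (ω : Ω) : ‖Q n ω‖ ≤ 1 := norm_prod_le_one _ fun _ _ ↦ h1 _
  have hT (n : ℕ) (ω : Ω) : ‖T n ω‖ ≤ 1 := tailWeight.norm_le_one hr.le h1 _
  have hle (n : ℕ) (ω : Ω) : ‖Q n ω * (1 - T n ω)‖ ≤ ‖1 - T n ω‖ := by
    rw [norm_mul]
    exact mul_le_of_le_one_left (norm_nonneg _) (hQ n ω)
  have hdiff : Tendsto (fun n ↦ ∫ ω, Q n ω * (1 - T n ω) ∂P) atTop (𝓝 (∫ _, 0 ∂P)) := by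
    refine tendsto_integral_of_dominated_convergence (fun _ ↦ 2) (fun n ↦ by fun_prop)
      (integrable_const 2) (fun n ↦ ae_of_all _ fun ω ↦ (hle n ω).trans ?_) ?_
    · exact (norm_sub_le _ _).trans (by rw [norm_one]; linarith [hT n ω])
    · filter_upwards [hG.ae_tendsto_atTop hr] with ω hω
      have hTω : Tendsto (fun n ↦ T n ω) atTop (𝓝 1) :=
        tailWeight.tendsto_atTop.comp ((tendsto_add_atTop_iff_nat 1).2 hω)
      exact squeeze_zero_norm (hle · ω) (by simpa using (hTω.const_sub 1).norm)
  have hsplit (n : ℕ) : ∫ ω, Q n ω ∂P = ∫ ω, Q n ω * (1 - T n ω) ∂P + tailWeight r h 0 := by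
    have hQi : Integrable (Q n) P := .of_bound (hQm n) 1 (ae_of_all _ (hQ n))
    rw [← hG.integral_prod_mul_tailWeight hr hm hi h1 hc n, ← sub_eq_iff_eq_add]
    have hQTi : Integrable (fun ω ↦ Q n ω * T n ω) P := hQi.mul_bdd (hTm n) (ae_of_all _ (hT n))
    calc
      _ = ∫ ω, (Q n ω - Q n ω * T n ω) ∂P := (integral_sub hQi hQTi).symm
      _ = _ := by simp only [mul_sub, mul_one]
  rw [integral_zero] at hdiff
  refine (tendsto_add_atTop_iff_nat 1).1 ?_
  simpa only [← hsplit, zero_add] using! hdiff.add_const (tailWeight r h 0)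

end IsPoissonArrivalTimes

section CharFun

lemma charFun_map_apply_real {Ω : Type*} [MeasurableSpace Ω] {P : Measure Ω} {S : Ω → ℝ}
    (hS : AEMeasurable S P) (t : ℝ) :
    charFun (P.map S) t = ∫ ω, Complex.exp (t * S ω * Complex.I) ∂P := by
  rw [charFun_apply_real, integral_map hS (by fun_prop)]

lemma charFun_map_const_add_comp {Ω : Type*} [MeasurableSpace Ω] {P : Measure Ω} {S : Ω → ℝ}
    (hS : AEMeasurable S P) (m t : ℝ) :
    charFun (P.map fun ω ↦ m + S ω) t =
      charFun (P.map S) t * Complex.exp ((m * t : ℝ) * Complex.I) := by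
  have h := charFun_map_const_add (μ := P.map S) m t
  rw [AEMeasurable.map_map_of_aemeasurable (by fun_prop) hS] at h
  simpa [mul_comm] using! h

lemma charFun_map_sum_mul {Ω ι : Type*} [MeasurableSpace Ω] {P : Measure Ω} [Countable ι]
    {C η : ι → Ω → ℝ} (hind : iIndepFun η P) (hη : ∀ i, AEMeasurable (η i) P)
    (hC : ∀ i, AEMeasurable (C i) P) (hCη : IndepFun (fun ω i ↦ C i ω) (fun ω i ↦ η i ω) P)
    (s : Finset ι) (t : ℝ) :
    charFun (P.map fun ω ↦ ∑ i ∈ s, C i ω * η i ω) t =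
      ∫ ω, ∏ i ∈ s, charFun (P.map (η i)) (t * C i ω) ∂P := by
  have := hind.isProbabilityMeasure
  let f (p : (ι → ℝ) × (ι → ℝ)) : ℂ :=
    Complex.exp (t * (∑ i ∈ s, p.1 i * p.2 i : ℝ) * Complex.I)
  have hf : Measurable f := by fun_prop
  have hint : Integrable (fun ω ↦ f (fun i ↦ C i ω, fun i ↦ η i ω)) P := by
    refine .of_bound (C := 1) (by fun_prop) (ae_of_all _ fun ω ↦ ?_)
    simp only [f]
    rw [← Complex.ofReal_mul, Complex.norm_exp_ofReal_mul_I]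
  rw [charFun_map_apply_real (by fun_prop)]
  refine (integral_comp_prodMk_of_indepFun hCη (by fun_prop) (by fun_prop) hf.stronglyMeasurable
    hint).trans (integral_congr_ae (ae_of_all _ fun ω ↦ ?_))
  have hind' : iIndepFun (fun i ω' ↦ C i ω * η i ω') P :=
    hind.comp (fun i y ↦ C i ω * y) fun i ↦ by fun_prop
  calc
    _ = charFun (P.map fun ω' ↦ ∑ i ∈ s, C i ω * η i ω') t :=
      (charFun_map_apply_real (by fun_prop) t).symm
    _ = ∏ i ∈ s, charFun (P.map fun ω' ↦ C i ω * η i ω') t := by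
      rw [(hind'.restrict s).charFun_map_fun_finsetSum_eq_prod (fun i _ ↦ by fun_prop),
        Finset.prod_apply]
    _ = _ := by simp_rw [fun i ↦ charFun_map_mul_comp (hη i), mul_comm t]

variable {μ : Measure ℝ}

lemma charFun_eq_integral_cos [IsFiniteMeasure μ] [μ.IsNegInvariant] (t : ℝ) :
    charFun μ t = (∫ x, Real.cos (t * x) ∂μ : ℝ) := by
  have hint (c : ℝ) : Integrable (fun x : ℝ ↦ Complex.exp (c * x * Complex.I)) μ := by
    refine .of_bound (C := 1) (by fun_prop) (ae_of_all _ fun x ↦ ?_)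
    rw [← Complex.ofReal_mul, Complex.norm_exp_ofReal_mul_I]
  have hneg : charFun μ t = ∫ x, Complex.exp ((-t : ℝ) * x * Complex.I) ∂μ := by
    rw [charFun_apply_real, ← integral_neg_eq_self]
    simp
  have htwo : 2 * charFun μ t = 2 * ((∫ x, Real.cos (t * x) ∂μ : ℝ) : ℂ) := by
    rw [two_mul]
    nth_rewrite 2 [hneg]
    rw [charFun_apply_real, ← integral_add (hint t) (hint (-t)), ← integral_complex_ofReal,
      ← integral_const_mul]
    congr with x
    rw [Complex.ofReal_cos, Complex.two_cos]
    push_cast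
    ring_nf
  exact mul_left_cancel₀ two_ne_zero htwo

lemma one_sub_charFun_eq_integral [IsProbabilityMeasure μ] [μ.IsNegInvariant] (t : ℝ) :
    1 - charFun μ t = (∫ x, (1 - Real.cos (t * x)) ∂μ : ℝ) := by
  have hint : Integrable (fun x ↦ Real.cos (t * x)) μ :=
    .of_bound (by fun_prop) 1 (ae_of_all _ fun x ↦ Real.abs_cos_le_one _)
  rw [charFun_eq_integral_cos, integral_sub (integrable_const 1) hint]
  simp

variable {α : ℝ} (h0 : 0 < α) (h2 : α < 2) (hμ : Integrable (fun y ↦ |y| ^ α) μ) (t : ℝ)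
include h0 h2

lemma integral_one_sub_cos_mul_mul_rpow (y : ℝ) :
    ∫ x in Ioi 0, (1 - Real.cos (t * x ^ (-α⁻¹) * y)) = |t| ^ α / stableConst α * |y| ^ α := by
  simp_rw [mul_right_comm t _ y]
  rw [integral_one_sub_cos_mul_rpow h0 h2, abs_mul, Real.mul_rpow (abs_nonneg _) (abs_nonneg _)]
  ring

include hμ

lemma integrable_one_sub_cos_mul_rpow_prod [SFinite μ] :
    Integrable (fun p : ℝ × ℝ ↦ 1 - Real.cos (t * p.1 ^ (-α⁻¹) * p.2))
      ((volume.restrict (Ioi 0)).prod μ) := by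
  rw [integrable_prod_iff' (by fun_prop)]
  refine ⟨ae_of_all _ fun y ↦ ?_, ?_⟩
  · simpa only [mul_right_comm t _ y, IntegrableOn] using
      integrableOn_one_sub_cos_mul_rpow h0 h2 (t * y)
  · simp only [Real.norm_of_nonneg (sub_nonneg.2 (Real.cos_le_one _)),
      integral_one_sub_cos_mul_mul_rpow h0 h2]
    exact hμ.const_mul _

lemma integrableOn_one_sub_charFun_mul_rpow [IsProbabilityMeasure μ] [μ.IsNegInvariant] :
    IntegrableOn (fun x ↦ 1 - charFun μ (t * x ^ (-α⁻¹))) (Ioi 0) := by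
  simp_rw [one_sub_charFun_eq_integral]
  exact (integrable_one_sub_cos_mul_rpow_prod h0 h2 hμ t).integral_prod_left.ofReal

lemma integral_one_sub_charFun_mul_rpow [IsProbabilityMeasure μ] [μ.IsNegInvariant] :
    ∫ x in Ioi 0, (1 - charFun μ (t * x ^ (-α⁻¹))) =
      (|t| ^ α * (∫ y, |y| ^ α ∂μ) / stableConst α : ℝ) := by
  simp_rw [one_sub_charFun_eq_integral]
  rw [integral_complex_ofReal, integral_integral_swap
    (integrable_one_sub_cos_mul_rpow_prod h0 h2 hμ t)]
  simp_rw [integral_one_sub_cos_mul_mul_rpow h0 h2]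
  rw [integral_const_mul, div_mul_eq_mul_div]

end CharFun

section LevyContinuity

variable {E : Type*} [NormedAddCommGroup E] [InnerProductSpace ℝ E] [FiniteDimensional ℝ E]
  [MeasurableSpace E] [BorelSpace E]

lemma exists_tendsto_of_tendsto_charFun {μ : ℕ → ProbabilityMeasure E} {f : E → ℂ}
    (hf : ContinuousAt f 0)
    (h : ∀ t, Tendsto (fun n ↦ charFun (μ n : Measure E) t) atTop (𝓝 (f t))) :
    ∃ ν : ProbabilityMeasure E, Tendsto μ atTop (𝓝 ν) ∧ charFun (ν : Measure E) = f := by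
  have htight := isTightMeasureSet_of_tendsto_charFun (μ := fun n ↦ (μ n : Measure E)) hf h
  have hcomp : IsCompact (closure (range μ)) :=
    isCompact_closure_of_isTightMeasureSet (by simpa [range] using htight)
  obtain ⟨ν, -, φ, hφ, hν⟩ := hcomp.isSeqCompact fun n ↦ subset_closure (mem_range_self n)
  have hchar : charFun (ν : Measure E) = f := funext fun t ↦ tendsto_nhds_unique
    (ProbabilityMeasure.tendsto_iff_tendsto_charFun.1 hν t) ((h t).comp hφ.tendsto_atTop)
  exact ⟨ν, ProbabilityMeasure.tendsto_iff_tendsto_charFun.2 fun t ↦ hchar ▸ h t, hchar⟩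

lemma exists_tendstoInDistribution_of_tendsto_charFun {Ω : Type*} [MeasurableSpace Ω]
    {P : Measure Ω} [IsProbabilityMeasure P] {Y : ℕ → Ω → E} (hY : ∀ n, AEMeasurable (Y n) P)
    {f : E → ℂ} (hf : ContinuousAt f 0)
    (h : ∀ t, Tendsto (fun n ↦ charFun (P.map (Y n)) t) atTop (𝓝 (f t))) :
    ∃ ν : ProbabilityMeasure E, TendstoInDistribution Y atTop id (fun _ ↦ P) (ν : Measure E) ∧
      charFun (ν : Measure E) = f := by
  obtain ⟨ν, hν, hchar⟩ := exists_tendsto_of_tendsto_charFun (E := E)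
    (μ := fun n ↦ ⟨P.map (Y n), Measure.isProbabilityMeasure_map (hY n)⟩) hf h
  exact ⟨ν, ⟨hY, aemeasurable_id, by simpa using! hν⟩, hchar⟩

end LevyContinuity

lemma stableExponent_zero_skewness (α σ m t : ℝ) :
    stableExponent α σ 0 m t = -((σ ^ α * |t| ^ α : ℝ) : ℂ) + Complex.I * ((m * t : ℝ) : ℂ) := by
  by_cases hα : α = 1 <;> simp [stableExponent, hα]

lemma continuous_stableExponent_zero_skewness {α : ℝ} (hα : 0 ≤ α) (σ m : ℝ) :
    Continuous (stableExponent α σ 0 m) := by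
  have : Continuous fun t : ℝ ↦ |t| ^ α := continuous_abs.rpow_const fun _ ↦ Or.inr hα
  simp_rw [funext (stableExponent_zero_skewness α σ m)]
  fun_prop

lemma isNegInvariant_map_of_identDistrib_neg {Ω G : Type*} [MeasurableSpace Ω]
    [MeasurableSpace G] [Neg G] [MeasurableNeg G] {P : Measure Ω} {X : Ω → G}
    (hX : IdentDistrib X (fun ω ↦ -X ω) P P) : (P.map X).IsNegInvariant := by
  refine ⟨?_⟩
  rw [Measure.neg, AEMeasurable.map_map_of_aemeasurable (by fun_prop) hX.aemeasurable_fst]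
  exact hX.map_eq.symm

section LePage

variable {Ω : Type*} [MeasurableSpace Ω] {P : Measure Ω} {r α : ℝ} {G η : ℕ → Ω → ℝ}

lemma tendsto_charFun_lePage_series (hr : 0 < r) (h0 : 0 < α) (h2 : α < 2)
    (hG : IsPoissonArrivalTimes r G P) {μ : Measure ℝ} [IsProbabilityMeasure μ] [μ.IsNegInvariant]
    (hμ : Integrable (fun y ↦ |y| ^ α) μ) (hind : iIndepFun η P) (hlaw : ∀ n, HasLaw (η n) μ P)
    (hGη : IndepFun (fun ω n ↦ G (n + 1) ω) (fun ω n ↦ η n ω) P) (t : ℝ) :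
    Tendsto (fun n ↦ charFun
        (P.map fun ω ↦ ∑ k ∈ Finset.range n, G (k + 1) ω ^ (-α⁻¹) * η k ω) t) atTop
      (𝓝 (Complex.exp (-(r * (|t| ^ α * (∫ y, |y| ^ α ∂μ) / stableConst α : ℝ))))) := by
  have hη (n : ℕ) : AEMeasurable (η n) P := (hlaw n).aemeasurable
  have hGm := hG.aemeasurable
  have hcoef : IndepFun (fun ω n ↦ G (n + 1) ω ^ (-α⁻¹)) (fun ω n ↦ η n ω) P :=
    hGη.comp (φ := fun (x : ℕ → ℝ) n ↦ x n ^ (-α⁻¹)) (by fun_prop) measurable_id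
  have hcharFun (n : ℕ) := charFun_map_sum_mul hind hη (fun k ↦ (hGm k).pow_const (-α⁻¹)) hcoef
    (Finset.range n) t
  simp_rw [hcharFun, fun k ↦ (hlaw k).map_eq]
  rw [← integral_one_sub_charFun_mul_rpow h0 h2 hμ t]
  have hrpow : ContinuousOn (fun x : ℝ ↦ t * x ^ (-α⁻¹)) (Ioi 0) :=
    continuousOn_const.mul (continuousOn_id.rpow_const fun x hx ↦ Or.inl (ne_of_gt hx))
  exact hG.tendsto_integral_prod (h := fun x ↦ charFun μ (t * x ^ (-α⁻¹))) hr
    (measurable_charFun.comp (by fun_prop)) (integrableOn_one_sub_charFun_mul_rpow h0 h2 hμ t)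
    (fun _ ↦ norm_charFun_le_one _) (continuous_charFun.comp_continuousOn hrpow)

lemma exists_tendstoInDistribution_lePage_series [IsProbabilityMeasure P] (hr : 0 < r)
    (h0 : 0 < α) (h2 : α < 2) (hG : IsPoissonArrivalTimes r G P) {μ : Measure ℝ}
    [IsProbabilityMeasure μ] [μ.IsNegInvariant] (hμ : Integrable (fun y ↦ |y| ^ α) μ)
    (hind : iIndepFun η P) (hlaw : ∀ n, HasLaw (η n) μ P)
    (hGη : IndepFun (fun ω n ↦ G (n + 1) ω) (fun ω n ↦ η n ω) P) (m : ℝ) :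
    ∃ ν : ProbabilityMeasure ℝ,
      TendstoInDistribution
        (fun n ω ↦ m + ∑ k ∈ Finset.range n, G (k + 1) ω ^ (-α⁻¹) * η k ω) atTop id (fun _ ↦ P)
        (ν : Measure ℝ) ∧
      IsStableLaw α ((r * (∫ y, |y| ^ α ∂μ) / stableConst α) ^ α⁻¹) 0 m (ν : Measure ℝ) := by
  have hη (n : ℕ) : AEMeasurable (η n) P := (hlaw n).aemeasurable
  have hGm := hG.aemeasurable
  have hc := stableConst_pos h0 h2
  have : 0 ≤ ∫ y, |y| ^ α ∂μ := integral_nonneg fun y ↦ by positivity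
  let S (n : ℕ) (ω : Ω) : ℝ := ∑ k ∈ Finset.range n, G (k + 1) ω ^ (-α⁻¹) * η k ω
  have hS (n : ℕ) : AEMeasurable (S n) P := by fun_prop
  set σ : ℝ := (r * (∫ y, |y| ^ α ∂μ) / stableConst α) ^ α⁻¹
  have hσ : σ ^ α = r * (∫ y, |y| ^ α ∂μ) / stableConst α :=
    Real.rpow_inv_rpow (by positivity) h0.ne'
  have hlim (t : ℝ) : Tendsto (fun n ↦ charFun (P.map fun ω ↦ m + S n ω) t) atTop
      (𝓝 (Complex.exp (stableExponent α σ 0 m t))) := by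
    simp_rw [charFun_map_const_add_comp (hS _)]
    convert! (tendsto_charFun_lePage_series hr h0 h2 hG hμ hind hlaw hGη t).mul_const _ using 2
    rw [stableExponent_zero_skewness, hσ, ← Complex.exp_add]
    push_cast
    ring_nf
  have hcont := (continuous_stableExponent_zero_skewness h0.le σ m).cexp.continuousAt (x := 0)
  obtain ⟨ν, hν, hchar⟩ := exists_tendstoInDistribution_of_tendsto_charFun
    (fun n ↦ (hS n).const_add m) hcont hlim
  exact ⟨ν, hν, h0, h2.le, by positivity, by simp, inferInstance, fun t ↦ congrFun hchar t⟩

end LePage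

lemma eq_rpow_mul_add_sum_of_recursion {a : ℝ} {g x e : ℕ → ℝ} (hg : ∀ n, 0 < g n)
    (hx : ∀ n, x (n + 1) = (g (n + 1) / g n) ^ a * x n + e n) (n : ℕ) :
    x n = g n ^ a * (x 0 / g 0 ^ a + ∑ k ∈ Finset.range n, g (k + 1) ^ (-a) * e k) := by
  have hga (n : ℕ) : g n ^ a ≠ 0 := (Real.rpow_pos_of_pos (hg n) a).ne'
  induction n with
  | zero => simp [mul_div_cancel₀ _ (hga 0)]
  | succ n ih =>
    rw [hx, ih, Finset.sum_range_succ, Real.div_rpow (hg _).le (hg _).le, Real.rpow_neg (hg _).le]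
    field_simp [hga n, hga (n + 1)]
    ring

lemma tendstoInDistribution_mul_of_ae_tendsto_one {Ω : Type*} [MeasurableSpace Ω] {P : Measure Ω}
    [IsProbabilityMeasure P] {ν : Measure ℝ} [IsProbabilityMeasure ν] {R Y : ℕ → Ω → ℝ}
    (hY : TendstoInDistribution Y atTop id (fun _ ↦ P) ν) (hRm : ∀ n, AEMeasurable (R n) P)
    (hR : ∀ᵐ ω ∂P, Tendsto (R · ω) atTop (𝓝 1)) :
    TendstoInDistribution (fun n ω ↦ R n ω * Y n ω) atTop id (fun _ ↦ P) ν := by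
  have hRP : TendstoInMeasure P R atTop fun _ ↦ 1 :=
    tendstoInMeasure_of_tendsto_ae (fun n ↦ (hRm n).aestronglyMeasurable) hR
  refine (hY.continuous_comp_prodMk_of_tendstoInMeasure_const (g := fun p : ℝ × ℝ ↦ p.2 * p.1)
    (by fun_prop) hRP hRm).congr (fun n ↦ by rfl) (ae_of_all _ fun x ↦ by simp)

theorem theorem1 {Ω : Type*} [MeasurableSpace Ω] (P : Measure Ω) [IsProbabilityMeasure P]
    (a α : ℝ) (ha : 1 / 2 < a) (hα : α = 1 / a)
    -- arrival times `G₁, G₂, …`, with the convention `G₀ = 1` for the recursion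
    (G : ℕ → Ω → ℝ) (hG : IsPoissonArrivalTimes 1 G P) (hG0 : ∀ ω, G 0 ω = 1)
    -- the innovations `ε₁, ε₂, …`; `ε 0` is not used
    (ε : ℕ → Ω → ℝ)
    (hε_indep : iIndepFun (fun n => ε (n + 1)) P)
    (hε_ident : ∀ n, IdentDistrib (ε (n + 1)) (ε 1) P P)
    (hε_G : IndepFun (fun ω (n : ℕ) => ε (n + 1) ω) (fun ω (n : ℕ) => G (n + 1) ω) P)
    (hε_symm : IdentDistrib (ε 1) (fun ω => -ε 1 ω) P P)
    (hε_moment : Integrable (fun ω => |ε 1 ω| ^ α) P)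
    (X : ℕ → Ω → ℝ) (hX0 : ∀ ω, X 0 ω = 1)
    (hX : ∀ n ω, X (n + 1) ω = (G (n + 1) ω / G n ω) ^ a * X n ω + ε (n + 1) ω) :
    ∃ ν : ProbabilityMeasure ℝ,
      TendstoInDistribution (fun (n : ℕ) ω => X n ω / (n : ℝ) ^ a) atTop (id : ℝ → ℝ)
        (fun _ => P) (ν : Measure ℝ) ∧
      IsStableLaw α (((∫ ω, |ε 1 ω| ^ α ∂P) / stableConst α) ^ a) 0 1 (ν : Measure ℝ) := by
  have h0 : 0 < α := by rw [hα]; positivity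
  have h2 : α < 2 := by rw [hα, one_div_lt (by positivity) two_pos]; exact ha
  obtain rfl : a = α⁻¹ := by rw [hα, one_div, inv_inv]
  have hGpos : ∀ᵐ ω ∂P, ∀ n, 0 < G n ω := by
    filter_upwards [hG.ae_forall_pos] with ω hω
    exact Nat.rec (hG0 ω ▸ one_pos) fun n _ ↦ hω n
  have hGm : ∀ n, AEMeasurable (G n) P :=
    Nat.rec (by simp [funext hG0]) fun n _ ↦ hG.aemeasurable n
  have hR : ∀ᵐ ω ∂P, Tendsto (fun n : ℕ ↦ (G n ω / n) ^ α⁻¹) atTop (𝓝 1) := by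
    filter_upwards [hG.ae_tendsto_div one_pos] with ω hω
    simpa using hω.rpow_const (p := α⁻¹) (by simp)
  have hpow : Measurable fun y : ℝ ↦ |y| ^ α := by fun_prop
  have hε : AEMeasurable (ε 1) P := hε_symm.aemeasurable_fst
  have := Measure.isProbabilityMeasure_map hε
  have := isNegInvariant_map_of_identDistrib_neg hε_symm
  obtain ⟨ν, hν, hstable⟩ := exists_tendstoInDistribution_lePage_series one_pos h0 h2 hG
    (μ := P.map (ε 1)) ((integrable_map_measure hpow.aestronglyMeasurable hε).2 hε_moment) hε_indep
    (fun n ↦ ⟨(hε_ident n).aemeasurable_fst, (hε_ident n).map_eq⟩) hε_G.symm 1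
  rw [integral_map hε hpow.aestronglyMeasurable, one_mul] at hstable
  refine ⟨ν, (tendstoInDistribution_mul_of_ae_tendsto_one hν (by fun_prop) hR).congr (fun n ↦ ?_)
    .rfl, hstable⟩
  filter_upwards [hGpos] with ω hω
  rw [eq_rpow_mul_add_sum_of_recursion (x := (X · ω)) hω (hX · ω) n, hX0, hG0, Real.one_rpow,
    div_one, Real.div_rpow (hω n).le n.cast_nonneg, div_mul_eq_mul_div]
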